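/- Let $X$ be a connected, locally finite, finite-dimensional (abstract) simplicial complex; $X(k)$ denotes its set of $k$-simplices. Let $m$ be an admissible weight on $X$: a positive function on the simplices such that $m(s)=\sum_{t\in X(k+1),\,t\supset s}m(t)$ for every $s\in X(k)$ that is contained in some $(k+1)$-simplex; write $m(x)$, $m(x,y)$, $m(x,y,y')$ for its values on $\{x\}$, $\{x,y\}$, $\{x,y,y'\}$. Assume that every $1$-simplex of $X$ is contained in a $2$-simplex. Let $\Gamma$ be a finitely generated group acting on $X$ by simplicial automorphisms preserving $m$, properly discontinuously and cofinitely (finitely many orbits of $k$-simplices for each $k$). Let $\mathcal F(0)\subset X(0)$ be a set of representatives of the $\Gamma$-orbits of vertices, and let $\Gamma_x$ be the stabilizer of the vertex $x$. For a vertex $x$, $(\mathrm{Lk}\,x)(0)$ is the set of vertices $y\ne x$ with $\{x,y\}\in X(1)$, and $(\overrightarrow{\mathrm{Lk}\,x})(1)$ is the set of ordered pairs $(y,y')$ with $\{x,y,y'\}\in X(2)$. Let $Y$ be a Hadamard space (a complete $\mathrm{CAT}(0)$ space). For $p\in Y$ let $S_pY$ be the space of directions: the completion of the set of nontrivial geodesics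 starting from $p$, two of them being identified if they enclose angle $0$, with the angle $\angle_p$ as metric. Let $TC_pY$ be the tangent cone, i.e. the cone $S_pY\times[0,\infty)/S_pY\times\{0\}$ with origin $0_p$ (equal to $\{0_p\}$ if $S_pY=\emptyset$) and the metric $$d_{TC_pY}\big((V,t),(V',t')\big)^2=t^2+t'^2-2tt'\cos\angle_p(V,V').$$ Let $\pi_p:Y\to TC_pY$ send $q\ne p$ to $([c],d_Y(p,q))$, where $c$ is the geodesic from $p$ to $q$, and $p$ to $0_p$. Let $\rho:\Gamma\to\mathrm{Isom}(Y)$ be a homomorphism and let $f:X(0)\to Y$ be $\rho$-equivariant, i.e. $f(\gamma x)=\rho(\gamma)f(x)$. Put $F_x(y)=\pi_{f(x)}(f(y))$, and let $-\Delta f(x)\in TC_{f(x)}Y$ be the barycenter of $\{F_x(y)\mid y\in(\mathrm{Lk}\,x)(0)\}$ with weights $m(x,y)/m(x)$, i.e. the unique minimizer of $W\mapsto\sum_{y}\frac{m(x,y)}{m(x)}d_{TC_{f(x)}Y}(F_x(y),W)^2$ (and $-\Delta f(x)=0_{f(x)}$ if $x$ has no neighbours). Then, writing $d_{TC}=d_{TC_{f(x)}Y}$,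 $$\begin{aligned}0=\sum_{x\in\mathcal F(0)}\frac1{|\Gamma_x|}\Big[&\sum_{(y,y')\in(\overrightarrow{\mathrm{Lk}\,x})(1)}m(x,y,y')\,d_{TC}(F_x(y),F_x(y'))^2-\sum_{y\in(\mathrm{Lk}\,x)(0)}m(x,y)\,d_{TC}(0_{f(x)},F_x(y))^2\\&+\sum_{(y,y')\in(\overrightarrow{\mathrm{Lk}\,x})(1)}m(x,y,y')\big\{d_Y(f(y),f(y'))^2-d_{TC}(F_x(y),F_x(y'))^2\big\}\Big]\end{aligned}$$ and $$\begin{aligned}\sum_{x\in\mathcal F(0)}\frac{m(x)}{|\Gamma_x|}&\,d_{TC}(0_{f(x)},-\Delta f(x))^2\\=\sum_{x\in\mathcal F(0)}\frac1{|\Gamma_x|}\Big[&\sum_{(y,y')\in(\overrightarrow{\mathrm{Lk}\,x})(1)}m(x,y,y')\,d_{TC}(F_x(y),F_x(y'))^2-\sum_{y\in(\mathrm{Lk}\,x)(0)}m(x,y)\,d_{TC}(-\Delta f(x),F_x(y))^2\\&+\sum_{(y,y')\in(\overrightarrow{\mathrm{Lk}\,x})(1)}m(x,y,y')\big\{d_Y(f(y),f(y'))^2-d_{TC}(F_x(y),F_x(y'))^2\big\}\Big].\end{aligned}$$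 Moreover, every curvature term is nonnegative: $d_Y(f(y),f(y'))^2-d_{TC}(F_x(y),F_x(y'))^2\ge0$ for all $x\in X(0)$ and $(y,y')\in(\overrightarrow{\mathrm{Lk}\,x})(1)$. -/

import Mathlib

open Filter Topology

noncomputable section

/-! ### Hadamard spaces -/

/-- `c` restricts to a geodesic of length `l` from `p` to `q`, that is, to an isometric embedding
of `[0, l]` with `c 0 = p` and `c l = q`. Values of `c` outside `[0, l]` play no role. -/
structure IsGeodesic {Y : Type*} [MetricSpace Y] (c : ℝ → Y) (l : ℝ) (p q : Y) : Prop where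
  nonneg : 0 ≤ l
  start : c 0 = p
  finish : c l = q
  isom : ∀ s ∈ Set.Icc 0 l, ∀ t ∈ Set.Icc 0 l, dist (c s) (c t) = |s - t|

/-- `CAT(0)` spaces: geodesic spaces all of whose geodesic triangles are at least as thin as their
comparison triangles in the Euclidean plane. Two points on one and the same side always have the
distance of their comparison points, and any two different sides of a triangle have a common
vertex; so the condition is stated for points at distances `s` and `t` from a vertex `p`, on the
sides `px` and `py`. -/
class IsCAT0 (Y : Type*) [MetricSpace Y] : Prop where
  exists_geodesic : ∀ p q : Y, ∃ (c : ℝ → Y) (l : ℝ), IsGeodesic c l p q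
  cat0 : ∀ (p x y : Y) (c c' : ℝ → Y) (l l' : ℝ), IsGeodesic c l p x → IsGeodesic c' l' p y →
    ∀ p₀ x₀ y₀ : EuclideanSpace ℝ (Fin 2),
      dist p₀ x₀ = dist p x → dist p₀ y₀ = dist p y → dist x₀ y₀ = dist x y →
      ∀ s ∈ Set.Icc 0 l, ∀ t ∈ Set.Icc 0 l',
        ∀ a ∈ segment ℝ p₀ x₀, ∀ b ∈ segment ℝ p₀ y₀, dist p₀ a = s → dist p₀ b = t →
          dist (c s) (c' t) ≤ dist a b

/-- A Hadamard space is a complete `CAT(0)` space. -/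
class IsHadamard (Y : Type*) [MetricSpace Y] : Prop extends IsCAT0 Y, CompleteSpace Y

/-! ### Angles, the space of directions, the tangent cone -/

/-- The angle opposite to the side of length `z` in a Euclidean triangle with sides `x`, `y`, `z`
(law of cosines). -/
def euclideanAngle (x y z : ℝ) : ℝ :=
  Real.arccos ((x ^ 2 + y ^ 2 - z ^ 2) / (2 * x * y))

/-- The angle at the vertex corresponding to `p` of a comparison triangle for `p`, `x`, `y`. -/
def comparisonAngle {Y : Type*} [MetricSpace Y] (p x y : Y) : ℝ :=
  euclideanAngle (dist p x) (dist p y) (dist x y)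

/-- Nontrivial geodesics starting from `p`. -/
structure GeodesicFrom {Y : Type*} [MetricSpace Y] (p : Y) where
  toFun : ℝ → Y
  len : ℝ
  endpoint : Y
  len_pos : 0 < len
  isGeodesic : IsGeodesic toFun len p endpoint

namespace GeodesicFrom

variable {Y : Type*} [MetricSpace Y] {p : Y}

/-- The angle at `p` between two geodesics starting from `p`. The upper limit is a limit if
`Y` is a `CAT(0)` space. -/
def angle (c c' : GeodesicFrom p) : ℝ :=
  limsup (fun t : ℝ × ℝ => comparisonAngle p (c.toFun t.1) (c'.toFun t.2))
    (𝓝[>] (0 : ℝ) ×ˢ 𝓝[>] (0 : ℝ))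

theorem dist_start (c : GeodesicFrom p) {t : ℝ} (h0 : 0 ≤ t) (h : t ≤ c.len) :
    dist p (c.toFun t) = t := by
  have := c.isGeodesic.isom 0 ⟨le_rfl, c.len_pos.le⟩ t ⟨h0, h⟩
  rw [c.isGeodesic.start] at this
  rw [this, zero_sub, abs_neg, abs_of_nonneg h0]

theorem comparisonAngle_nonneg (p x y : Y) : 0 ≤ comparisonAngle p x y := Real.arccos_nonneg _

theorem comparisonAngle_le_pi (p x y : Y) : comparisonAngle p x y ≤ Real.pi := Real.arccos_le_pi _

theorem isBoundedUnder_le (c c' : GeodesicFrom p) :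
    IsBoundedUnder (· ≤ ·) (𝓝[>] (0 : ℝ) ×ˢ 𝓝[>] (0 : ℝ))
      (fun t : ℝ × ℝ => comparisonAngle p (c.toFun t.1) (c'.toFun t.2)) :=
  isBoundedUnder_of ⟨Real.pi, fun _ => comparisonAngle_le_pi _ _ _⟩

theorem isBoundedUnder_ge (c c' : GeodesicFrom p) :
    IsBoundedUnder (· ≥ ·) (𝓝[>] (0 : ℝ) ×ˢ 𝓝[>] (0 : ℝ))
      (fun t : ℝ × ℝ => comparisonAngle p (c.toFun t.1) (c'.toFun t.2)) :=
  isBoundedUnder_of ⟨0, fun _ => comparisonAngle_nonneg _ _ _⟩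

theorem angle_nonneg (c c' : GeodesicFrom p) : 0 ≤ angle c c' :=
  le_limsup_of_frequently_le
    (Eventually.of_forall fun _ => comparisonAngle_nonneg _ _ _).frequently
    (isBoundedUnder_le c c')

theorem eventually_small {r : ℝ} (hr : 0 < r) :
    ∀ᶠ t : ℝ × ℝ in 𝓝[>] (0 : ℝ) ×ˢ 𝓝[>] (0 : ℝ), t.1 ∈ Set.Ioo 0 r ∧ t.2 ∈ Set.Ioo 0 r :=
  prod_mem_prod (Ioo_mem_nhdsGT hr) (Ioo_mem_nhdsGT hr)

theorem angle_self (c : GeodesicFrom p) : angle c c = 0 := by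
  have h : (fun t : ℝ × ℝ => comparisonAngle p (c.toFun t.1) (c.toFun t.2))
      =ᶠ[𝓝[>] (0 : ℝ) ×ˢ 𝓝[>] (0 : ℝ)] fun _ => (0 : ℝ) := by
    filter_upwards [eventually_small c.len_pos] with t ht
    obtain ⟨⟨h1, h2⟩, h3, h4⟩ := ht
    unfold comparisonAngle euclideanAngle
    rw [c.dist_start h1.le h2.le, c.dist_start h3.le h4.le,
      c.isGeodesic.isom _ ⟨h1.le, h2.le⟩ _ ⟨h3.le, h4.le⟩, sq_abs]
    have : (t.1 ^ 2 + t.2 ^ 2 - (t.1 - t.2) ^ 2) / (2 * t.1 * t.2) = 1 := by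
      field_simp
      ring
    rw [this, Real.arccos_one]
  rw [angle, limsup_congr h, limsup_const]

theorem angle_comm (c c' : GeodesicFrom p) : angle c c' = angle c' c := by
  unfold angle
  conv_rhs => rw [Filter.prod_comm]
  rw [← Filter.limsup_comp]
  congr 1
  funext t
  simp only [Function.comp, Prod.fst_swap, Prod.snd_swap, comparisonAngle, euclideanAngle]
  rw [dist_comm (c.toFun t.1)]
  ring_nf

/-- A point on the third ray of a planar configuration: sides `x` and `z` enclosing the angle
`a + b < π` are cut by a segment at distance `y`. -/
theorem exists_cut {x z a b : ℝ} (hx : 0 < x) (hz : 0 < z) (ha : 0 < a) (hb : 0 < b)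
    (hab : a + b < Real.pi) :
    ∃ y u v : ℝ, 0 < y ∧ y ≤ max x z ∧ 0 ≤ u ∧ 0 ≤ v ∧
      u ^ 2 = x ^ 2 + y ^ 2 - 2 * x * y * Real.cos a ∧
      v ^ 2 = y ^ 2 + z ^ 2 - 2 * y * z * Real.cos b ∧
      (u + v) ^ 2 = x ^ 2 + z ^ 2 - 2 * x * z * Real.cos (a + b) := by
  have hsa : 0 < Real.sin a := Real.sin_pos_of_pos_of_lt_pi ha (by linarith)
  have hsb : 0 < Real.sin b := Real.sin_pos_of_pos_of_lt_pi hb (by linarith)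
  have hsab : 0 < Real.sin (a + b) := Real.sin_pos_of_pos_of_lt_pi (by linarith) hab
  set D : ℝ := x * Real.sin a + z * Real.sin b with hD
  have hDpos : 0 < D := by positivity
  set L : ℝ := z * Real.sin b / D with hL
  set M : ℝ := x * Real.sin a / D with hM
  have hL0 : 0 < L := by positivity
  have hM0 : 0 < M := by positivity
  have hLM : L + M = 1 := by
    rw [hL, hM, ← add_div, div_eq_one_iff_eq hDpos.ne', hD]
    ring
  have e1 : L * (x * Real.sin a) = M * (z * Real.sin b) := by
    rw [hL, hM]
    ring
  set y : ℝ := L * (x * Real.cos a) + M * (z * Real.cos b) with hy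
  have hy' : y = x * z * Real.sin (a + b) / D := by
    rw [hy, hL, hM, Real.sin_add]
    ring
  have hy0 : 0 < y := by
    rw [hy']
    positivity
  have s1 := Real.sin_sq_add_cos_sq a
  have s2 := Real.sin_sq_add_cos_sq b
  have hM1 : M = 1 - L := by linarith
  -- the squared length of the whole segment
  set Q : ℝ := x ^ 2 + z ^ 2 - 2 * x * z * Real.cos (a + b) with hQ
  have hQ' : Q = (x * Real.cos a - z * Real.cos b) ^ 2 + (x * Real.sin a + z * Real.sin b) ^ 2 := by
    rw [hQ, Real.cos_add]
    linear_combination (-x ^ 2) * s1 + (-z ^ 2) * s2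
  have hQ0 : 0 ≤ Q := by
    rw [hQ']
    positivity
  have hu : (M * Real.sqrt Q) ^ 2 = x ^ 2 + y ^ 2 - 2 * x * y * Real.cos a := by
    rw [mul_pow, Real.sq_sqrt hQ0, hQ']
    have h1 : x * Real.cos a - y = M * (x * Real.cos a - z * Real.cos b) := by
      rw [hy]
      linear_combination (-(x * Real.cos a)) * hLM
    have h2 : x * Real.sin a = M * (x * Real.sin a + z * Real.sin b) := by
      linear_combination (-(x * Real.sin a)) * hLM + e1
    calc M ^ 2 * ((x * Real.cos a - z * Real.cos b) ^ 2 + (x * Real.sin a + z * Real.sin b) ^ 2)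
        = (M * (x * Real.cos a - z * Real.cos b)) ^ 2
          + (M * (x * Real.sin a + z * Real.sin b)) ^ 2 := by ring
      _ = (x * Real.cos a - y) ^ 2 + (x * Real.sin a) ^ 2 := by rw [← h1, ← h2]
      _ = _ := by linear_combination x ^ 2 * s1
  have hv : (L * Real.sqrt Q) ^ 2 = y ^ 2 + z ^ 2 - 2 * y * z * Real.cos b := by
    rw [mul_pow, Real.sq_sqrt hQ0, hQ']
    have h1 : y - z * Real.cos b = L * (x * Real.cos a - z * Real.cos b) := by
      rw [hy]
      linear_combination (z * Real.cos b) * hLM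
    have h2 : z * Real.sin b = L * (x * Real.sin a + z * Real.sin b) := by
      linear_combination (-(z * Real.sin b)) * hLM - e1
    calc L ^ 2 * ((x * Real.cos a - z * Real.cos b) ^ 2 + (x * Real.sin a + z * Real.sin b) ^ 2)
        = (L * (x * Real.cos a - z * Real.cos b)) ^ 2
          + (L * (x * Real.sin a + z * Real.sin b)) ^ 2 := by ring
      _ = (y - z * Real.cos b) ^ 2 + (z * Real.sin b) ^ 2 := by rw [← h1, ← h2]
      _ = _ := by linear_combination z ^ 2 * s2
  refine ⟨y, M * Real.sqrt Q, L * Real.sqrt Q, hy0, ?_, by positivity, by positivity, hu, hv, ?_⟩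
  · have h1 : x * Real.cos a ≤ max x z :=
      (mul_le_of_le_one_right hx.le (Real.cos_le_one a)).trans (le_max_left _ _)
    have h2 : z * Real.cos b ≤ max x z :=
      (mul_le_of_le_one_right hz.le (Real.cos_le_one b)).trans (le_max_right _ _)
    calc y ≤ L * max x z + M * max x z :=
          add_le_add (mul_le_mul_of_nonneg_left h1 hL0.le) (mul_le_mul_of_nonneg_left h2 hM0.le)
      _ = max x z := by rw [← add_mul, hLM, one_mul]
  · have : M * Real.sqrt Q + L * Real.sqrt Q = Real.sqrt Q := by
      rw [← add_mul, add_comm M, hLM, one_mul]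
    rw [this, Real.sq_sqrt hQ0]

/-- A triangle side is shorter than the side prescribed by an angle larger than the actual one. -/
theorem lt_of_euclideanAngle_lt {x y z u a : ℝ} (hx : 0 < x) (hy : 0 < y) (hu : 0 ≤ u)
    (ha : a ≤ Real.pi) (hua : u ^ 2 = x ^ 2 + y ^ 2 - 2 * x * y * Real.cos a)
    (h : euclideanAngle x y z < a) : z < u := by
  have h0 : 0 ≤ a := (Real.arccos_nonneg _).trans h.le
  have h1 : Real.cos a < (x ^ 2 + y ^ 2 - z ^ 2) / (2 * x * y) := by
    by_contra hcon
    push Not at hcon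
    have := Real.arccos_le_arccos hcon
    rw [Real.arccos_cos h0 ha] at this
    exact absurd h (not_lt.mpr this)
  rw [lt_div_iff₀ (by positivity)] at h1
  refine lt_of_pow_lt_pow_left₀ 2 hu ?_
  nlinarith

theorem euclideanAngle_lt_of_lt {x y z u a : ℝ} (hx : 0 < x) (hy : 0 < y) (hz : 0 ≤ z)
    (h0 : 0 ≤ a) (ha : a ≤ Real.pi) (hua : u ^ 2 = x ^ 2 + y ^ 2 - 2 * x * y * Real.cos a)
    (h : z ≤ u) : euclideanAngle x y z ≤ a := by
  have h1 : Real.cos a ≤ (x ^ 2 + y ^ 2 - z ^ 2) / (2 * x * y) := by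
    rw [le_div_iff₀ (by positivity)]
    nlinarith [pow_le_pow_left₀ hz h 2]
  have := Real.arccos_le_arccos h1
  rwa [Real.arccos_cos h0 ha] at this

theorem angle_triangle (c₁ c₂ c₃ : GeodesicFrom p) :
    angle c₁ c₃ ≤ angle c₁ c₂ + angle c₂ c₃ := by
  by_contra hcon
  push Not at hcon
  set δ : ℝ := (angle c₁ c₃ - (angle c₁ c₂ + angle c₂ c₃)) / 4 with hδ
  have hδ0 : 0 < δ := by
    rw [hδ]
    linarith
  set a : ℝ := angle c₁ c₂ + δ with ha
  set b : ℝ := angle c₂ c₃ + δ with hb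
  have ha0 : 0 < a := by linarith [angle_nonneg c₁ c₂]
  have hb0 : 0 < b := by linarith [angle_nonneg c₂ c₃]
  have hab : a + b < angle c₁ c₃ := by linarith
  have E1 := eventually_lt_of_limsup_lt (show angle c₁ c₂ < a by linarith)
    (isBoundedUnder_le c₁ c₂)
  have E2 := eventually_lt_of_limsup_lt (show angle c₂ c₃ < b by linarith)
    (isBoundedUnder_le c₂ c₃)
  have F := frequently_lt_of_lt_limsup (isBoundedUnder_ge c₁ c₃).isCoboundedUnder_le hab
  -- eventually for both coordinates below a common bound
  have key : ∀ {P : ℝ × ℝ → Prop}, (∀ᶠ t in 𝓝[>] (0 : ℝ) ×ˢ 𝓝[>] (0 : ℝ), P t) →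
      ∃ r > 0, ∀ s t : ℝ, 0 < s → s < r → 0 < t → t < r → P (s, t) := by
    intro P hP
    obtain ⟨A, hA, B, hB, hAB⟩ := eventually_prod_iff.mp hP
    obtain ⟨r, hr, hr'⟩ := mem_nhdsGT_iff_exists_Ioo_subset.mp hA
    obtain ⟨r₂, hr₂, hr₂'⟩ := mem_nhdsGT_iff_exists_Ioo_subset.mp hB
    refine ⟨min r r₂, lt_min hr hr₂, fun s t h1 h2 h3 h4 => hAB ?_ ?_⟩
    · exact hr' ⟨h1, h2.trans_le (min_le_left _ _)⟩
    · exact hr₂' ⟨h3, h4.trans_le (min_le_right _ _)⟩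
  obtain ⟨r₁, hr₁, H1⟩ := key E1
  obtain ⟨r₂, hr₂, H2⟩ := key E2
  set r : ℝ := min (min r₁ r₂) (min c₁.len (min c₂.len c₃.len)) with hr
  have hr0 : 0 < r := by
    simp only [hr, lt_min_iff]
    exact ⟨⟨hr₁, hr₂⟩, c₁.len_pos, c₂.len_pos, c₃.len_pos⟩
  obtain ⟨⟨x, z⟩, hlt, ⟨hx0, hxr⟩, hz0, hzr⟩ := (F.and_eventually (eventually_small hr0)).exists
  simp only at hlt hx0 hxr hz0 hzr
  have habpi : a + b < Real.pi := hlt.trans_le (comparisonAngle_le_pi _ _ _)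
  obtain ⟨y, u, v, hy0, hy, hu0, hv0, hu, hv, huv⟩ := exists_cut hx0 hz0 ha0 hb0 habpi
  have hyr : y < r := hy.trans_lt (max_lt hxr hzr)
  simp only [hr, lt_min_iff] at hxr hyr hzr
  have d1 := c₁.dist_start hx0.le hxr.2.1.le
  have d2 := c₂.dist_start hy0.le hyr.2.2.1.le
  have d3 := c₃.dist_start hz0.le hzr.2.2.2.le
  have L1 := H1 x y hx0 hxr.1.1 hy0 hyr.1.1
  have L2 := H2 y z hy0 hyr.1.2 hz0 hzr.1.2
  simp only [comparisonAngle, d1, d2, d3] at L1 L2 hlt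
  have K1 := lt_of_euclideanAngle_lt hx0 hy0 hu0 (by linarith) hu L1
  have K2 := lt_of_euclideanAngle_lt hy0 hz0 hv0 (by linarith) hv L2
  have K3 : dist (c₁.toFun x) (c₃.toFun z) ≤ u + v :=
    (dist_triangle _ (c₂.toFun y) _).trans (add_le_add K1.le K2.le)
  have := euclideanAngle_lt_of_lt hx0 hz0 dist_nonneg (by linarith) habpi.le huv K3
  linarith

/-- The angle is a pseudo-metric on the set of nontrivial geodesics starting from `p`. -/
instance : PseudoMetricSpace (GeodesicFrom p) where
  dist := angle
  dist_self := angle_self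
  dist_comm := angle_comm
  dist_triangle := angle_triangle

end GeodesicFrom

/-- The space of directions `S_p Y`: the completion of the metric space obtained from the set of
nontrivial geodesics starting from `p`, with the angle as distance, by identifying geodesics that
enclose the angle `0`. -/
abbrev DirectionSpace {Y : Type*} [MetricSpace Y] (p : Y) : Type _ :=
  UniformSpace.Completion (SeparationQuotient (GeodesicFrom p))

/-- The class in `S_p Y` of a nontrivial geodesic starting from `p`. -/
def GeodesicFrom.direction {Y : Type*} [MetricSpace Y] {p : Y} (c : GeodesicFrom p) :
    DirectionSpace p :=
  ((SeparationQuotient.mk c : SeparationQuotient (GeodesicFrom p)) :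
    UniformSpace.Completion (SeparationQuotient (GeodesicFrom p)))

/-- The tangent cone `TC_p Y`, the Euclidean cone over `S_p Y`. Its points are the apex `0_p` and
the pairs `(V, t)` with `V` a direction and `t > 0`; this is `S_p Y × [0, ∞)` with
`S_p Y × {0}` collapsed to a point (and the cone is `{0_p}` if there are no directions). -/
inductive TangentCone {Y : Type*} [MetricSpace Y] (p : Y) : Type _
  | origin : TangentCone p
  | ray (V : DirectionSpace p) (t : ℝ) (ht : 0 < t) : TangentCone p

namespace TangentCone

variable {Y : Type*} [MetricSpace Y] {p : Y}

/-- The length `|W|`. -/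
def length : TangentCone p → ℝ
  | origin => 0
  | ray _ t _ => t

/-- The `inner product` `⟨(V, t), (V', t')⟩ = t t' cos ∠(V, V')`. -/
def innerProduct : TangentCone p → TangentCone p → ℝ
  | ray V t _, ray V' t' _ => t * t' * Real.cos (dist V V')
  | _, _ => 0

/-- The cone metric `d(W, W')² = |W|² + |W'|² - 2 ⟨W, W'⟩`. -/
instance : Dist (TangentCone p) where
  dist W W' := Real.sqrt (W.length ^ 2 + W'.length ^ 2 - 2 * innerProduct W W')

open Classical in
/-- The map `π_p : Y → TC_p Y` that sends `q` to `([c], d(p, q))`, with `c` the geodesic from `p`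
to `q`, and `p` itself to the origin. -/
def proj [IsCAT0 Y] (p q : Y) : TangentCone p :=
  if h : p = q then origin else
    let c := (IsCAT0.exists_geodesic p q).choose
    let hl := (IsCAT0.exists_geodesic p q).choose_spec
    let l := hl.choose
    let hc : IsGeodesic c l p q := hl.choose_spec
    ray
      (GeodesicFrom.direction ⟨c, l, q,
        lt_of_le_of_ne hc.nonneg fun h0 => h (by
          have h1 := hc.start
          rw [h0] at h1
          exact h1.symm.trans hc.finish), hc⟩)
      (dist p q) (dist_pos.mpr h)

end TangentCone

/-! ### Barycenters -/

/-- `q` minimizes `∑ᵢ tᵢ d(pᵢ, q)²`, the sum being over the (finite) set `I`. -/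
def IsBarycenter {T ι : Type*} [Dist T] (I : Set ι) (w : ι → ℝ) (P : ι → T) (q : T) : Prop :=
  ∀ q' : T, ∑ᶠ i ∈ I, w i * dist (P i) q ^ 2 ≤ ∑ᶠ i ∈ I, w i * dist (P i) q' ^ 2

/-! ### Weighted simplicial complexes with a group action

Vertices form the type `V`, and the `k`-simplices are the faces with `k + 1` elements. -/

section Complex

variable {V : Type*} [DecidableEq V]

/-- `X(k)`. -/
def kSimplices (X : AbstractSimplicialComplex V) (k : ℕ) : Set (Finset V) :=
  {s | s ∈ X.faces ∧ s.card = k + 1}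

/-- `X(k)_s`: the `k`-simplices that contain `s`. -/
def kSimplicesAt (X : AbstractSimplicialComplex V) (k : ℕ) (s : Finset V) : Set (Finset V) :=
  {t | t ∈ kSimplices X k ∧ s ⊆ t}

/-- Any two vertices are joined by an edge path. -/
def IsConnectedComplex (X : AbstractSimplicialComplex V) : Prop :=
  ∀ x y : V, Relation.ReflTransGen (fun a b => ({a, b} : Finset V) ∈ X.faces) x y

/-- Every vertex belongs to finitely many simplices. -/
def IsLocallyFiniteComplex (X : AbstractSimplicialComplex V) : Prop :=
  ∀ x : V, {s | s ∈ X.faces ∧ x ∈ s}.Finite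

/-- The dimensions of the simplices are bounded. -/
def IsFiniteDimensionalComplex (X : AbstractSimplicialComplex V) : Prop :=
  ∃ n : ℕ, ∀ s ∈ X.faces, s.card ≤ n + 1

/-- Admissible weights: positive functions on simplices such that `m(s)` is the sum of the `m(t)`
over the simplices `t ⊃ s` of the next dimension, whenever there are any. -/
structure IsAdmissibleWeight (X : AbstractSimplicialComplex V) (m : Finset V → ℝ) : Prop where
  pos : ∀ s ∈ X.faces, 0 < m s
  sum_eq : ∀ (k : ℕ), ∀ s ∈ kSimplices X k, (kSimplicesAt X (k + 1) s).Nonempty →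
    m s = ∑ᶠ t ∈ kSimplicesAt X (k + 1) s, m t

/-- The vertices of the link of the vertex `x`. -/
def linkVertices (X : AbstractSimplicialComplex V) (x : V) : Set V :=
  {y | y ≠ x ∧ ({x, y} : Finset V) ∈ X.faces}

/-- The ordered `1`-simplices of the link of the vertex `x`. -/
def linkEdges (X : AbstractSimplicialComplex V) (x : V) : Set (V × V) :=
  {e | e.1 ≠ x ∧ e.2 ≠ x ∧ e.1 ≠ e.2 ∧ ({x, e.1, e.2} : Finset V) ∈ X.faces}

variable (Γ : Type*) [Group Γ] [MulAction Γ V]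

/-- `Γ` acts by automorphisms of the weighted complex `(X, m)`. -/
structure ActsByAutomorphisms (X : AbstractSimplicialComplex V) (m : Finset V → ℝ) : Prop where
  faces_mem : ∀ (γ : Γ), ∀ s ∈ X.faces, s.image (fun x => γ • x) ∈ X.faces
  weight_eq : ∀ (γ : Γ), ∀ s ∈ X.faces, m (s.image (fun x => γ • x)) = m s

variable (V) in
/-- The action is properly discontinuous: for every finite set `K` of vertices, only finitely many
`γ` have `γ K ∩ K ≠ ∅`. -/
def ActsProperlyDiscontinuously : Prop :=
  ∀ K : Finset V, {γ : Γ | ∃ x ∈ K, γ • x ∈ K}.Finite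

/-- There are finitely many orbits of `k`-simplices, for each `k`. -/
def ActsCofinitely (X : AbstractSimplicialComplex V) : Prop :=
  ∀ k : ℕ, ∃ F : Finset (Finset V), (∀ s ∈ F, s ∈ kSimplices X k) ∧
    ∀ s ∈ kSimplices X k, ∃ γ : Γ, s.image (fun x => γ • x) ∈ F

/-- `F` is a set of representatives of the `Γ`-orbits of vertices. -/
def IsOrbitRepresentatives (F : Finset V) : Prop :=
  ∀ x : V, ∃! y : V, y ∈ F ∧ y ∈ MulAction.orbit Γ x

end Complex

/-! ### Maps into a Hadamard space -/

section Maps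

variable {V Y : Type*} [DecidableEq V] [MetricSpace Y]

/-- `F_x(y) = π_{f(x)}(f(y))`. -/
def linkMap [IsCAT0 Y] (f : V → Y) (x y : V) : TangentCone (f x) :=
  TangentCone.proj (f x) (f y)

open Classical in
/-- `-Δf(x)`: the barycenter in `TC_{f(x)} Y` of the points `F_x(y)`, for `y` in the link of `x`,
with the weights `m(x, y) / m(x)`. (A barycenter exists and is unique as soon as `x` has a
neighbour; otherwise the value is the origin by convention.) -/
def negLaplacian [IsCAT0 Y] (X : AbstractSimplicialComplex V) (m : Finset V → ℝ) (f : V → Y)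
    (x : V) : TangentCone (f x) :=
  if h : ∃! W : TangentCone (f x),
      IsBarycenter (linkVertices X x) (fun y => m {x, y} / m {x}) (linkMap f x) W
  then h.choose else TangentCone.origin

/-- The first sum in the bracket at `x`: `∑ m(x, y, y') d(F_x(y), F_x(y'))²`. -/
def tangentSum [IsCAT0 Y] (X : AbstractSimplicialComplex V) (m : Finset V → ℝ) (f : V → Y)
    (x : V) : ℝ :=
  ∑ᶠ e ∈ linkEdges X x, m {x, e.1, e.2} * dist (linkMap f x e.1) (linkMap f x e.2) ^ 2

/-- The radial sum at `x` with centre `W`: `∑ m(x, y) d(W, F_x(y))²`. -/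
def radialSum [IsCAT0 Y] (X : AbstractSimplicialComplex V) (m : Finset V → ℝ) (f : V → Y)
    (x : V) (W : TangentCone (f x)) : ℝ :=
  ∑ᶠ y ∈ linkVertices X x, m {x, y} * dist W (linkMap f x y) ^ 2

/-- The curvature term `d(f(y), f(y'))² - d(F_x(y), F_x(y'))²`. -/
def curvatureTerm [IsCAT0 Y] (f : V → Y) (x y y' : V) : ℝ :=
  dist (f y) (f y') ^ 2 - dist (linkMap f x y) (linkMap f x y') ^ 2

/-- The third sum in the bracket at `x`. -/
def curvatureSum [IsCAT0 Y] (X : AbstractSimplicialComplex V) (m : Finset V → ℝ) (f : V → Y)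
    (x : V) : ℝ :=
  ∑ᶠ e ∈ linkEdges X x, m {x, e.1, e.2} * curvatureTerm f x e.1 e.2

end Maps

end

/-! Two of the three claims are statements at a single vertex; only the first formula is global.

In the first bracket the cone distances between the $F_x(y)$ cancel, and
$d_{TC}(0,F_x(y))=d_Y(f(x),f(y))$. What must be shown is that, after summation with the factors
$1/|\Gamma_x|$, the sum of $m(x,y,y')\,d_Y(f(y),f(y'))^2$ over link edges equals the sum of
$m(x,y)\,d_Y(f(x),f(y))^2$ over link vertices. Admissibility rewrites the latter as a sum of
$m(x,y,y')\,d_Y(f(x),f(y'))^2$ over link edges. Both sides now run over ordered triangles and differ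
by exchanging the base vertex $x$ with $y$, which mass transport permits
(`IsOrbitRepresentatives.mass_transport`, `IsAdmissibleWeight.sum_linkEdges_eq_sum_linkVertices`).

The second formula is the first plus a pointwise identity: moving the centre of the radial sum from
the apex to $B=-\Delta f(x)$ lowers it by exactly $m(x)|B|^2$ (`radialSum_origin_sub`). A tangent
cone need not be a vector space, but it admits scaling along rays, and minimality of $B$ against its
multiples $aB$ already gives the first-order condition that is needed
(`IsBarycenter.sum_innerProduct`).

Nonnegativity of the curvature terms says that $\pi_p$ is distance nonincreasing. This follows from
the law of cosines, because in a CAT(0) space an angle is at most its comparison angle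
(`TangentCone.dist_proj_sq_le`). -/

noncomputable section

/-! ### Comparison of angles in `CAT(0)` spaces -/

/-- The point of the Euclidean plane with polar coordinates `r`, `θ`. -/
def planePoint (r θ : ℝ) : EuclideanSpace ℝ (Fin 2) := !₂[r * Real.cos θ, r * Real.sin θ]

theorem dist_planePoint (r r' θ θ' : ℝ) :
    dist (planePoint r θ) (planePoint r' θ')
      = Real.sqrt (r ^ 2 + r' ^ 2 - 2 * r * r' * Real.cos (θ - θ')) := by
  rw [EuclideanSpace.dist_eq]
  congr 1
  simp only [planePoint, Fin.sum_univ_two, Real.dist_eq, sq_abs, Real.cos_sub]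
  simp only [Matrix.cons_val_zero, Matrix.cons_val_one]
  linear_combination r ^ 2 * Real.sin_sq_add_cos_sq θ + r' ^ 2 * Real.sin_sq_add_cos_sq θ'

theorem dist_zero_planePoint {r : ℝ} (hr : 0 ≤ r) (θ : ℝ) :
    dist (0 : EuclideanSpace ℝ (Fin 2)) (planePoint r θ) = r := by
  have h : (0 : EuclideanSpace ℝ (Fin 2)) = planePoint 0 θ := by
    ext i
    fin_cases i <;> simp [planePoint]
  rw [h, dist_planePoint, sub_self, Real.cos_zero]
  ring_nf
  exact Real.sqrt_sq hr

theorem planePoint_mem_segment {s l : ℝ} (hs : 0 ≤ s) (hl : 0 < l) (hsl : s ≤ l) (θ : ℝ) :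
    planePoint s θ ∈ segment ℝ 0 (planePoint l θ) := by
  refine ⟨1 - s / l, s / l, by rw [sub_nonneg]; exact div_le_one_of_le₀ hsl hl.le,
    by positivity, by ring, ?_⟩
  ext i
  fin_cases i <;> simp [planePoint] <;> field_simp

/-- The law of cosines for the comparison angle. -/
theorem dist_sq_eq_comparisonAngle {Y : Type*} [MetricSpace Y] {p x y : Y} (hx : p ≠ x)
    (hy : p ≠ y) :
    dist x y ^ 2 = dist p x ^ 2 + dist p y ^ 2
      - 2 * dist p x * dist p y * Real.cos (comparisonAngle p x y) := by
  have hx0 := dist_pos.mpr hx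
  have hy0 := dist_pos.mpr hy
  have h1 := dist_triangle x p y
  have h2 := dist_triangle p x y
  have h3 := dist_triangle p y x
  rw [dist_comm x p] at h1
  rw [dist_comm y x] at h3
  unfold comparisonAngle euclideanAngle
  -- The triangle inequalities place the quotient in $[-1,1]$, where `arccos` does not truncate.
  rw [Real.cos_arccos]
  · field_simp
    ring
  · rw [le_div_iff₀ (by positivity)]
    nlinarith [dist_nonneg (x := x) (y := y)]
  · rw [div_le_iff₀ (by positivity)]
    nlinarith [dist_nonneg (x := x) (y := y)]

namespace GeodesicFrom

variable {Y : Type*} [MetricSpace Y] {p : Y}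

theorem dist_endpoint (c : GeodesicFrom p) : dist p c.endpoint = c.len := by
  rw [← c.isGeodesic.finish]
  exact c.dist_start c.len_pos.le le_rfl

theorem ne_endpoint (c : GeodesicFrom p) : p ≠ c.endpoint :=
  dist_pos.mp (c.dist_endpoint ▸ c.len_pos)

/-- Put the comparison triangle in the plane with its vertex at the origin and its sides along the
polar angles $\alpha$ and $0$. The comparison points at radii $s$ and $t$ still subtend $\alpha$, so
the CAT(0) inequality bounds the third side by the one that $\alpha$ prescribes. -/
theorem comparisonAngle_le [IsCAT0 Y] (c c' : GeodesicFrom p) {s t : ℝ} (hs : 0 < s)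
    (hsl : s ≤ c.len) (ht : 0 < t) (htl : t ≤ c'.len) :
    comparisonAngle p (c.toFun s) (c'.toFun t)
      ≤ comparisonAngle p c.endpoint c'.endpoint := by
  set α := comparisonAngle p c.endpoint c'.endpoint with hα
  have hlaw := dist_sq_eq_comparisonAngle c.ne_endpoint c'.ne_endpoint
  rw [← hα, c.dist_endpoint, c'.dist_endpoint] at hlaw
  have hd : dist (planePoint c.len α) (planePoint c'.len 0) = dist c.endpoint c'.endpoint := by
    rw [dist_planePoint, sub_zero, ← hlaw, Real.sqrt_sq dist_nonneg]
  have key := IsCAT0.cat0 p c.endpoint c'.endpoint c.toFun c'.toFun c.len c'.len c.isGeodesic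
    c'.isGeodesic 0 (planePoint c.len α) (planePoint c'.len 0)
    (by rw [dist_zero_planePoint c.len_pos.le, c.dist_endpoint])
    (by rw [dist_zero_planePoint c'.len_pos.le, c'.dist_endpoint]) hd
    s ⟨hs.le, hsl⟩ t ⟨ht.le, htl⟩ _ (planePoint_mem_segment hs.le c.len_pos hsl α)
    _ (planePoint_mem_segment ht.le c'.len_pos htl 0)
    (dist_zero_planePoint hs.le _) (dist_zero_planePoint ht.le _)
  rw [dist_planePoint, sub_zero] at key
  unfold comparisonAngle
  rw [c.dist_start hs.le hsl, c'.dist_start ht.le htl]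
  refine euclideanAngle_lt_of_lt hs ht dist_nonneg (comparisonAngle_nonneg _ _ _)
    (comparisonAngle_le_pi _ _ _) (Real.sq_sqrt ?_) key
  nlinarith [sq_nonneg (s - t), Real.cos_le_one α, mul_pos hs ht]

/-- In a `CAT(0)` space angles are at most the comparison angles. -/
theorem angle_le_comparisonAngle [IsCAT0 Y] (c c' : GeodesicFrom p) :
    angle c c' ≤ comparisonAngle p c.endpoint c'.endpoint := by
  refine limsup_le_of_le (isBoundedUnder_ge c c').isCoboundedUnder_le ?_
  filter_upwards [eventually_small c.len_pos, eventually_small c'.len_pos] with t h h'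
  exact comparisonAngle_le c c' h.1.1 h.1.2.le h'.2.1 h'.2.2.le

theorem dist_direction (c c' : GeodesicFrom p) : dist c.direction c'.direction = angle c c' := by
  unfold direction
  rw [UniformSpace.Completion.dist_eq, SeparationQuotient.dist_mk]
  rfl

end GeodesicFrom

namespace TangentCone

variable {Y : Type*} [MetricSpace Y] {p : Y}

theorem length_origin : (origin : TangentCone p).length = 0 := rfl

theorem length_ray (U : DirectionSpace p) {t : ℝ} (ht : 0 < t) : (ray U t ht).length = t := rfl

theorem innerProduct_le (W W' : TangentCone p) : innerProduct W W' ≤ W.length * W'.length := by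
  cases W with
  | origin => simp [innerProduct, length]
  | ray U t ht =>
    cases W' with
    | origin => simp [innerProduct, length]
    | ray U' t' ht' =>
      exact mul_le_of_le_one_right (mul_pos ht ht').le (Real.cos_le_one _)

theorem dist_sq (W W' : TangentCone p) :
    dist W W' ^ 2 = W.length ^ 2 + W'.length ^ 2 - 2 * innerProduct W W' :=
  Real.sq_sqrt (by nlinarith [innerProduct_le W W', sq_nonneg (W.length - W'.length)])

theorem innerProduct_comm (W W' : TangentCone p) : innerProduct W W' = innerProduct W' W := by
  cases W <;> cases W' <;> simp [innerProduct, dist_comm, mul_comm]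

theorem innerProduct_origin_left (W : TangentCone p) : innerProduct origin W = 0 := by
  cases W <;> rfl

theorem dist_origin_sq (W : TangentCone p) : dist origin W ^ 2 = W.length ^ 2 := by
  rw [dist_sq, innerProduct_origin_left]
  simp [length]

/-- Homogeneity along a ray: this is all the linear structure of the cone that the variational
argument for barycenters uses. -/
theorem innerProduct_ray_right (W : TangentCone p) (U : DirectionSpace p) {t : ℝ} (ht : 0 < t)
    {a : ℝ} (ha : 0 < a) :
    innerProduct W (ray U (a * t) (mul_pos ha ht)) = a * innerProduct W (ray U t ht) := by
  cases W with
  | origin => simp [innerProduct]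
  | ray U' t' ht' =>
    simp only [innerProduct]
    ring

theorem proj_self [IsCAT0 Y] (p : Y) : proj p p = origin := by
  simp [proj]

/-- Hides the choice of geodesic in `proj`. The later estimates hold for any geodesic with the right
endpoint, so its uniqueness plays no role. -/
theorem exists_proj_eq [IsCAT0 Y] {q : Y} (h : p ≠ q) :
    ∃ c : GeodesicFrom p, c.endpoint = q ∧ proj p q = ray c.direction (dist p q) (dist_pos.mpr h) := by
  unfold proj
  rw [dif_neg h]
  exact ⟨_, rfl, rfl⟩

theorem length_proj [IsCAT0 Y] (p q : Y) : (proj p q).length = dist p q := by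
  by_cases h : p = q
  · subst h
    simp [proj_self, length]
  · obtain ⟨c, -, hc⟩ := exists_proj_eq h
    rw [hc]
    rfl

/-- The map `π_p` does not increase distances. -/
theorem dist_proj_sq_le [IsCAT0 Y] (p q q' : Y) :
    dist (proj p q) (proj p q') ^ 2 ≤ dist q q' ^ 2 := by
  by_cases h : p = q
  · subst h
    rw [proj_self, dist_origin_sq, length_proj]
  by_cases h' : p = q'
  · subst h'
    rw [dist_sq, innerProduct_comm, proj_self, innerProduct_origin_left]
    rw [length_proj, length_origin, dist_comm]
    simp
  obtain ⟨c, rfl, hc⟩ := exists_proj_eq h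
  obtain ⟨c', rfl, hc'⟩ := exists_proj_eq h'
  rw [dist_sq, length_proj, length_proj, dist_sq_eq_comparisonAngle h h', hc, hc']
  -- Cosine decreases on $[0,\pi]$, so the smaller angle, which is the one in the cone, has the
  -- larger cosine and hence the shorter opposite side.
  have hcos : Real.cos (comparisonAngle p c.endpoint c'.endpoint)
      ≤ Real.cos (dist c.direction c'.direction) := by
    rw [GeodesicFrom.dist_direction]
    exact Real.cos_le_cos_of_nonneg_of_le_pi (GeodesicFrom.angle_nonneg c c')
      (GeodesicFrom.comparisonAngle_le_pi _ _ _) (GeodesicFrom.angle_le_comparisonAngle c c')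
  have := mul_le_mul_of_nonneg_left hcos
    (mul_pos (dist_pos.mpr h) (dist_pos.mpr h')).le
  simp only [innerProduct]
  linarith

end TangentCone

theorem curvatureTerm_nonneg {V Y : Type*} [MetricSpace Y] [IsCAT0 Y]
    (f : V → Y) (x y y' : V) : 0 ≤ curvatureTerm f x y y' :=
  sub_nonneg.mpr (TangentCone.dist_proj_sq_le _ _ _)

/-! ### Barycenters in the tangent cone -/

/-- A barycenter `B` in the tangent cone satisfies `∑ wᵢ ⟨Pᵢ, B⟩ = ∑ wᵢ |B|²`. -/
theorem IsBarycenter.sum_innerProduct {Y ι : Type*} [MetricSpace Y] {p : Y} {I : Finset ι}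
    {w : ι → ℝ} {P : ι → TangentCone p} {B : TangentCone p}
    (hB : IsBarycenter (I : Set ι) w P B) :
    ∑ i ∈ I, w i * TangentCone.innerProduct (P i) B = (∑ i ∈ I, w i) * B.length ^ 2 := by
  cases B with
  | origin => simp [TangentCone.innerProduct_comm _ TangentCone.origin,
      TangentCone.innerProduct_origin_left, TangentCone.length]
  | ray U t ht =>
    set b := ∑ i ∈ I, w i * TangentCone.innerProduct (P i) (.ray U t ht) with hb
    set A := (∑ i ∈ I, w i) * t ^ 2 with hA
    -- Compare $B$ with $aB$: up to a constant the objective is the quadratic $Aa^2-2ba$, minimal at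
    -- the interior point $a=1$. Vanishing of its derivative there is the claim; no sign of the
    -- weights is needed.
    have key : ∀ a : ℝ, 0 < a → A - 2 * b ≤ A * a ^ 2 - 2 * b * a := by
      intro a ha
      have h := hB (.ray U (a * t) (mul_pos ha ht))
      simp only [finsum_mem_coe_finset, TangentCone.dist_sq,
        TangentCone.innerProduct_ray_right _ _ ht ha] at h
      have e : ∀ L a : ℝ, ∑ i ∈ I, w i * ((P i).length ^ 2 + L
          - 2 * (a * TangentCone.innerProduct (P i) (.ray U t ht)))
          = ∑ i ∈ I, w i * (P i).length ^ 2 + (∑ i ∈ I, w i) * L - 2 * a * b := by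
        intro L a
        rw [hb, Finset.sum_mul, Finset.mul_sum, ← Finset.sum_add_distrib,
          ← Finset.sum_sub_distrib]
        exact Finset.sum_congr rfl fun i _ => by ring
      have e1 := e (t ^ 2) 1
      have e2 := e ((a * t) ^ 2) a
      simp only [one_mul] at e1
      simp only [TangentCone.length_ray] at h
      simp only [e1, e2] at h
      rw [hA]
      linarith
    show b = A
    have hlim : ∀ ε : ℝ, |ε| < 1 → 0 ≤ ε * (2 * (A - b) + A * ε) := fun ε hε => by
      have := key (1 + ε) (by linarith [(abs_lt.mp hε).1])
      linarith
    by_contra hne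
    have hd : 0 < |A - b| := abs_pos.mpr (sub_ne_zero.mpr (Ne.symm hne))
    set K := |A| + |A - b| + 1 with hK
    have hK0 : 0 < K := by positivity
    -- A step against the sign of the derivative. This $K$ makes it shorter than $1$ and ensures
    -- $2K>A$, so the linear term outweighs the quadratic one.
    have h := hlim (-(A - b) / K) (by
      rw [abs_div, abs_neg, abs_of_pos hK0, div_lt_one hK0]
      linarith [abs_nonneg A])
    have h2 : -(A - b) / K * (2 * (A - b) + A * (-(A - b) / K))
        = -((A - b) ^ 2 / K ^ 2 * (2 * K - A)) := by
      field_simp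
      ring
    rw [h2] at h
    have h3 : 0 < 2 * K - A := by linarith [le_abs_self A]
    have h4 : 0 < (A - b) ^ 2 := by positivity
    have : 0 < (A - b) ^ 2 / K ^ 2 * (2 * K - A) := by positivity
    linarith

/-! ### Mass transport for properly discontinuous actions -/

section MassTransport

variable {V Γ : Type*} [Group Γ] [MulAction Γ V]

/-- The elements carrying $x$ to $\delta x$ form the left coset $\delta\Gamma_x$. -/
theorem ncard_smul_eq {x v : V} (h : v ∈ MulAction.orbit Γ x) :
    {γ : Γ | γ • x = v}.ncard = Nat.card (MulAction.stabilizer Γ x) := by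
  obtain ⟨δ, rfl⟩ := h
  have e : {γ : Γ | γ • x = δ • x} = (fun γ => δ * γ) '' (MulAction.stabilizer Γ x : Set Γ) := by
    ext γ
    constructor
    · intro hγ
      refine ⟨δ⁻¹ * γ, ?_, by simp⟩
      simp only [Set.mem_ofPred_eq] at hγ
      simp [MulAction.mem_stabilizer_iff, mul_smul, hγ]
    · rintro ⟨γ', hγ', rfl⟩
      simp only [SetLike.mem_coe, MulAction.mem_stabilizer_iff] at hγ'
      simp [mul_smul, hγ']
  show {γ : Γ | γ • x = δ • x}.ncard = _
  rw [e, Set.ncard_image_of_injective _ (mul_right_injective δ), ← Nat.card_coe_set_eq]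
  rfl

variable [DecidableEq V]

theorem ActsProperlyDiscontinuously.finite_smul_mem (hpd : ActsProperlyDiscontinuously V Γ)
    (x : V) (S : Finset V) : {γ : Γ | γ • x ∈ S}.Finite :=
  (hpd (insert x S)).subset fun _ hγ =>
    ⟨x, Finset.mem_insert_self _ _, Finset.mem_insert_of_mem hγ⟩

theorem ActsProperlyDiscontinuously.card_stabilizer_pos (hpd : ActsProperlyDiscontinuously V Γ)
    (x : V) : 0 < Nat.card (MulAction.stabilizer Γ x) := by
  have : Finite (MulAction.stabilizer Γ x) :=
    ((hpd.finite_smul_mem x {x}).subset fun γ hγ => by simpa using hγ :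
      (MulAction.stabilizer Γ x : Set Γ).Finite)
  exact Nat.card_pos

/-- A sum over the group along an orbit, as a sum over the orbit. -/
theorem ActsProperlyDiscontinuously.finsum_smul (hpd : ActsProperlyDiscontinuously V Γ)
    (x : V) {g : V → ℝ} {S : Finset V} (hS : Function.support g ⊆ S) :
    ∑ᶠ γ : Γ, g (γ • x)
      = ∑ v ∈ S, open Classical in
        if v ∈ MulAction.orbit Γ x then Nat.card (MulAction.stabilizer Γ x) * g v else 0 := by
  classical
  have hfin := hpd.finite_smul_mem x S
  -- Group the elements $\gamma$ by the vertex $\gamma x$; a fibre is a coset of the stabilizer, or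
  -- empty off the orbit.
  rw [finsum_eq_sum_of_support_subset (s := hfin.toFinset) _ (fun γ hγ => by
      simpa using hS hγ),
    ← Finset.sum_fiberwise_of_maps_to (t := S) (g := fun γ : Γ => γ • x) (by simp)]
  refine Finset.sum_congr rfl fun v hv => ?_
  rw [Finset.sum_congr rfl (g := fun _ => g v) (fun γ hγ => by rw [(Finset.mem_filter.mp hγ).2]),
    Finset.sum_const, nsmul_eq_mul]
  have e : (({γ ∈ hfin.toFinset | γ • x = v} : Finset Γ) : Set Γ) = {γ : Γ | γ • x = v} := by
    ext γ
    simp only [Finset.coe_filter, Set.Finite.mem_toFinset, Set.mem_ofPred_eq]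
    exact ⟨fun h => h.2, fun h => ⟨h ▸ hv, h⟩⟩
  rw [← Set.ncard_coe_finset, e]
  split_ifs with h
  · rw [ncard_smul_eq h]
  · have : {γ : Γ | γ • x = v} = ∅ := by
      ext γ
      simp only [Set.mem_ofPred_eq, Set.mem_empty_iff_false, iff_false]
      exact fun hγ => h ⟨γ, hγ⟩
    simp [this]

/-- Unfolding of a sum over all vertices. -/
theorem IsOrbitRepresentatives.finsum_eq (hpd : ActsProperlyDiscontinuously V Γ)
    {F : Finset V} (hF : IsOrbitRepresentatives Γ F) {g : V → ℝ}
    (hg : (Function.support g).Finite) :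
    ∑ᶠ v, g v = ∑ x ∈ F, 1 / (Nat.card (MulAction.stabilizer Γ x) : ℝ) * ∑ᶠ γ : Γ, g (γ • x) := by
  classical
  have hS : Function.support g ⊆ (hg.toFinset : Set V) := by simp
  rw [finsum_eq_sum_of_support_subset _ hS]
  simp only [hpd.finsum_smul _ hS, Finset.mul_sum]
  rw [Finset.sum_comm]
  refine Finset.sum_congr rfl fun v _ => ?_
  -- Only the representative of the orbit of $v$ contributes, and its $|\Gamma_y|$ repetitions
  -- cancel the factor $1/|\Gamma_y|$.
  obtain ⟨y, ⟨hyF, hy⟩, huniq⟩ := hF v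
  rw [Finset.sum_eq_single_of_mem y hyF]
  · rw [if_pos (MulAction.orbit_eq_iff.mpr hy ▸ MulAction.mem_orbit_self v)]
    have : (Nat.card (MulAction.stabilizer Γ y) : ℝ) ≠ 0 :=
      Nat.cast_ne_zero.mpr (hpd.card_stabilizer_pos y).ne'
    field_simp
  · intro x hx hxy
    rw [if_neg, mul_zero]
    exact fun h => hxy (huniq x ⟨hx, MulAction.orbit_eq_iff.mpr h ▸ MulAction.mem_orbit_self x⟩)

/-- The mass transport principle. -/
theorem IsOrbitRepresentatives.mass_transport (hpd : ActsProperlyDiscontinuously V Γ)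
    {F : Finset V} (hF : IsOrbitRepresentatives Γ F) {Ψ : V → V → ℝ}
    (hinv : ∀ (γ : Γ) x y, Ψ (γ • x) (γ • y) = Ψ x y)
    (h₁ : ∀ x, (Function.support fun y => Ψ x y).Finite)
    (h₂ : ∀ y, (Function.support fun x => Ψ x y).Finite) :
    ∑ x ∈ F, 1 / (Nat.card (MulAction.stabilizer Γ x) : ℝ) * ∑ᶠ y, Ψ x y
      = ∑ x ∈ F, 1 / (Nat.card (MulAction.stabilizer Γ x) : ℝ) * ∑ᶠ y, Ψ y x := by
  -- Both sides become sums over two representatives and a group element. Interchanging the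
  -- representatives and replacing $\gamma$ by $\gamma^{-1}$ matches them, by invariance of $\Psi$.
  simp only [hF.finsum_eq hpd (h₁ _), hF.finsum_eq hpd (h₂ _), Finset.mul_sum]
  rw [Finset.sum_comm]
  refine Finset.sum_congr rfl fun x _ => Finset.sum_congr rfl fun y _ => ?_
  rw [← finsum_comp_equiv (Equiv.inv Γ)]
  have : ∀ γ : Γ, Ψ y ((Equiv.inv Γ) γ • x) = Ψ (γ • y) x := fun γ => by
    rw [← hinv γ, Equiv.inv_apply, smul_inv_smul]
  simp only [this]
  ring

end MassTransport

/-! ### Links in weighted complexes -/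

section Links

variable {V : Type*} [DecidableEq V] {X : AbstractSimplicialComplex V}

theorem mem_linkEdges_swap {x y z : V} : (y, z) ∈ linkEdges X x ↔ (z, y) ∈ linkEdges X x := by
  simp only [linkEdges, Set.mem_ofPred_eq, Finset.pair_comm y z]
  tauto

theorem mem_linkEdges_rotate {x y z : V} : (y, z) ∈ linkEdges X x ↔ (x, z) ∈ linkEdges X y := by
  simp only [linkEdges, Set.mem_ofPred_eq, Finset.insert_comm x y, ne_comm (a := x) (b := y)]
  tauto

theorem mem_linkVertices_of_mem_linkEdges {x y z : V} (h : (y, z) ∈ linkEdges X x) :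
    y ∈ linkVertices X x :=
  ⟨h.1, X.isRelLowerSet_faces.mem_of_le h.2.2.2
    (show ({x, y} : Finset V) ⊆ {x, y, z} by
      intro a ha
      simp only [Finset.mem_insert, Finset.mem_singleton] at ha ⊢
      tauto) (by simp)⟩

theorem mem_linkVertices_comm {x y : V} : y ∈ linkVertices X x ↔ x ∈ linkVertices X y := by
  simp only [linkVertices, Set.mem_ofPred_eq, Finset.pair_comm x y, ne_comm (a := x) (b := y)]

theorem IsLocallyFiniteComplex.finite_linkVertices (hlf : IsLocallyFiniteComplex X) (x : V) :
    (linkVertices X x).Finite := by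
  refine Set.Finite.subset ((hlf x).biUnion fun s _ => s.finite_toSet) fun y hy => ?_
  simp only [Set.mem_iUnion]
  exact ⟨{x, y}, ⟨hy.2, by simp⟩, by simp⟩

theorem IsLocallyFiniteComplex.finite_linkEdges (hlf : IsLocallyFiniteComplex X) (x : V) :
    (linkEdges X x).Finite :=
  ((hlf.finite_linkVertices x).prod (hlf.finite_linkVertices x)).subset fun _ he =>
    ⟨mem_linkVertices_of_mem_linkEdges he,
      mem_linkVertices_of_mem_linkEdges (mem_linkEdges_swap.mp he)⟩

theorem pair_mem_kSimplices {x y : V} (h : y ∈ linkVertices X x) : {x, y} ∈ kSimplices X 1 :=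
  ⟨h.2, Finset.card_pair h.1.symm⟩

/-- Enumeration of the simplices that contain `s` and have one vertex more. -/
theorem bijOn_insert_kSimplicesAt {k : ℕ} {s : Finset V} (hs : s.card = k + 1) :
    Set.BijOn (fun z => insert z s) {z | z ∉ s ∧ insert z s ∈ X.faces}
      (kSimplicesAt X (k + 1) s) := by
  refine ⟨fun z hz => ⟨⟨hz.2, ?_⟩, Finset.subset_insert _ _⟩, fun z hz z' hz' h => ?_, ?_⟩
  · rw [Finset.card_insert_of_notMem hz.1, hs]
  · simp only at h
    have : z ∈ insert z' s := h ▸ Finset.mem_insert_self z s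
    exact (Finset.mem_insert.mp this).resolve_right hz.1
  · rintro t ⟨⟨ht, hc⟩, hst⟩
    obtain ⟨z, hz⟩ := Finset.card_eq_one.mp (show (t \ s).card = 1 by
      rw [Finset.card_sdiff_of_subset hst, hc, hs]
      omega)
    have hzt : z ∈ t \ s := hz ▸ Finset.mem_singleton_self z
    have : insert z s = t := by
      rw [← Finset.sdiff_union_of_subset hst, hz]
      rfl
    exact ⟨z, ⟨(Finset.mem_sdiff.mp hzt).2, this ▸ ht⟩, this⟩

variable {m : Finset V → ℝ}

theorem IsAdmissibleWeight.vertex_eq (hm : IsAdmissibleWeight X m) {x : V}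
    (h : (linkVertices X x).Nonempty) :
    m {x} = ∑ᶠ y ∈ linkVertices X x, m {x, y} := by
  have e : linkVertices X x = {z | z ∉ ({x} : Finset V) ∧ insert z {x} ∈ X.faces} := by
    ext z
    simp [linkVertices, Finset.pair_comm x z]
  have hb := bijOn_insert_kSimplicesAt (X := X) (Finset.card_singleton x)
  rw [← e] at hb
  rw [hm.sum_eq 0 {x} ⟨X.singleton_mem x, Finset.card_singleton x⟩ (hb.image_eq ▸ h.image _)]
  exact (finsum_mem_eq_of_bijOn _ hb fun z _ => by rw [Finset.pair_comm]).symm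

/-- Here `hedge` makes admissibility applicable to the edge. With $y$ fixed in one slot, each
triangle on the edge occurs once, so no factor $2$ appears. -/
theorem IsAdmissibleWeight.edge_eq (hm : IsAdmissibleWeight X m)
    (hedge : ∀ s ∈ kSimplices X 1, (kSimplicesAt X 2 s).Nonempty) {x y : V}
    (h : y ∈ linkVertices X x) :
    m {x, y} = ∑ᶠ z ∈ {z | (z, y) ∈ linkEdges X x}, m {x, z, y} := by
  have hs := pair_mem_kSimplices h
  rw [hm.sum_eq 1 _ hs (hedge _ hs)]
  have e : {z | (z, y) ∈ linkEdges X x}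
      = {z | z ∉ ({x, y} : Finset V) ∧ insert z {x, y} ∈ X.faces} := by
    ext z
    have := h.1
    simp only [linkEdges, Set.mem_ofPred_eq, Finset.mem_insert, Finset.mem_singleton,
      Finset.insert_comm z x]
    tauto
  have hb := bijOn_insert_kSimplicesAt (X := X) hs.2
  rw [← e] at hb
  exact (finsum_mem_eq_of_bijOn _ hb fun z _ => by rw [Finset.insert_comm]).symm

/-- A sum over the edges of a link, as an iterated sum. -/
theorem IsLocallyFiniteComplex.finsum_linkEdges (hlf : IsLocallyFiniteComplex X) (x : V)
    (φ : V → V → ℝ) :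
    ∑ᶠ e ∈ linkEdges X x, φ e.1 e.2
      = ∑ᶠ (y) (z), (linkEdges X x).indicator (fun e => φ e.1 e.2) (y, z) := by
  rw [finsum_mem_def, finsum_curry]
  exact (hlf.finite_linkEdges x).subset Set.support_indicator_subset

/-- The sum over the edges of a link of a function of the first vertex. -/
theorem IsAdmissibleWeight.sum_linkEdges (hm : IsAdmissibleWeight X m)
    (hlf : IsLocallyFiniteComplex X)
    (hedge : ∀ s ∈ kSimplices X 1, (kSimplicesAt X 2 s).Nonempty) (x : V) (g : V → ℝ) :
    ∑ᶠ e ∈ linkEdges X x, m {x, e.1, e.2} * g e.2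
      = ∑ᶠ y ∈ linkVertices X x, m {x, y} * g y := by
  -- The swap makes the argument of $g$ the outer summation variable, so that the inner sum is the
  -- one in `edge_eq`.
  have hb : Set.BijOn Prod.swap (linkEdges X x) (linkEdges X x) :=
    ⟨fun e he => mem_linkEdges_swap.mp he, Prod.swap_injective.injOn,
      fun e he => ⟨e.swap, mem_linkEdges_swap.mp he, rfl⟩⟩
  rw [finsum_mem_eq_of_bijOn (f := fun e : V × V => m {x, e.1, e.2} * g e.2) (g := fun e : V × V => m {x, e.2, e.1} * g e.1) Prod.swap hb
      (fun _ _ => rfl), hlf.finsum_linkEdges x fun y z => m {x, z, y} * g y, finsum_mem_def]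
  refine finsum_congr fun y => ?_
  by_cases hy : y ∈ linkVertices X x
  · rw [Set.indicator_of_mem hy, hm.edge_eq hedge hy, finsum_mem_def, finsum_mul]
    refine finsum_congr fun z => ?_
    by_cases hz : (z, y) ∈ linkEdges X x
    · rw [Set.indicator_of_mem (mem_linkEdges_swap.mp hz),
        Set.indicator_of_mem (show z ∈ {z | (z, y) ∈ linkEdges X x} from hz)]
    · rw [Set.indicator_of_notMem (fun h => hz (mem_linkEdges_swap.mp h)),
        Set.indicator_of_notMem (show z ∉ {z | (z, y) ∈ linkEdges X x} from hz), zero_mul]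
  · rw [Set.indicator_of_notMem hy]
    refine finsum_eq_zero_of_forall_eq_zero fun z => Set.indicator_of_notMem (fun h => hy ?_) _
    exact mem_linkVertices_of_mem_linkEdges h

variable {Γ : Type*} [Group Γ] [MulAction Γ V]

theorem ActsByAutomorphisms.smul_mem_linkEdges_iff (haut : ActsByAutomorphisms Γ X m) (γ : Γ)
    {x y z : V} : (γ • y, γ • z) ∈ linkEdges X (γ • x) ↔ (y, z) ∈ linkEdges X x := by
  have key : ∀ (γ : Γ) {x y z : V}, (y, z) ∈ linkEdges X x →
      (γ • y, γ • z) ∈ linkEdges X (γ • x) := fun γ x y z h => by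
    have := haut.faces_mem γ _ h.2.2.2
    simp only [Finset.image_insert, Finset.image_singleton] at this
    exact ⟨(MulAction.injective γ).ne h.1, (MulAction.injective γ).ne h.2.1,
      (MulAction.injective γ).ne h.2.2.1, this⟩
  refine ⟨fun h => ?_, key γ⟩
  simpa using key γ⁻¹ h

/-- Summed over representatives of the vertices, an invariant symmetric function of the edges of
the links gives the same as its sum over the edges issuing from the vertices. -/
theorem IsAdmissibleWeight.sum_linkEdges_eq_sum_linkVertices (hm : IsAdmissibleWeight X m)
    (hlf : IsLocallyFiniteComplex X)
    (hedge : ∀ s ∈ kSimplices X 1, (kSimplicesAt X 2 s).Nonempty)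
    (haut : ActsByAutomorphisms Γ X m) (hpd : ActsProperlyDiscontinuously V Γ)
    {F : Finset V} (hF : IsOrbitRepresentatives Γ F)
    {g : V → V → ℝ} (hg : ∀ (γ : Γ) x y, g (γ • x) (γ • y) = g x y) :
    ∑ x ∈ F, 1 / (Nat.card (MulAction.stabilizer Γ x) : ℝ) *
        ∑ᶠ e ∈ linkEdges X x, m {x, e.1, e.2} * g e.1 e.2
      = ∑ x ∈ F, 1 / (Nat.card (MulAction.stabilizer Γ x) : ℝ) *
        ∑ᶠ y ∈ linkVertices X x, m {x, y} * g x y := by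
  -- Spread each edge weight over its triangles, so that both sides become sums over ordered
  -- triangles.
  simp only [← fun x => hm.sum_linkEdges hlf hedge x (g x)]
  simp only [fun x => hlf.finsum_linkEdges x fun y z => m {x, y, z} * g y z,
    fun x => hlf.finsum_linkEdges x fun y z => m {x, y, z} * g x z]
  have hzero : ∀ x y, y ∉ linkVertices X x →
      ∑ᶠ z, (linkEdges X x).indicator (fun e => m {x, e.1, e.2} * g e.1 e.2) (y, z) = 0 :=
    fun x y hy => finsum_eq_zero_of_forall_eq_zero fun z =>
      Set.indicator_of_notMem (fun h => hy (mem_linkVertices_of_mem_linkEdges h)) _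
  -- Let $x$ send to $y$ the mass $\sum_z m(x,y,z)\,g(y,z)$. What $x$ receives from $y$ is $\sum_z
  -- m(y,x,z)\,g(x,z)$, the other side; only invariance of $g$ is used.
  rw [hF.mass_transport hpd (Ψ := fun x y =>
    ∑ᶠ z, (linkEdges X x).indicator (fun e => m {x, e.1, e.2} * g e.1 e.2) (y, z))]
  · refine Finset.sum_congr rfl fun x _ => ?_
    congr 1
    refine finsum_congr fun y => finsum_congr fun z => ?_
    by_cases h : (y, z) ∈ linkEdges X x
    · rw [Set.indicator_of_mem h, Set.indicator_of_mem (mem_linkEdges_rotate.mp h),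
        Finset.insert_comm]
    · rw [Set.indicator_of_notMem h,
        Set.indicator_of_notMem fun h' => h (mem_linkEdges_rotate.mpr h')]
  · intro γ x y
    rw [← finsum_comp_equiv (MulAction.toPerm γ : Equiv.Perm V)]
    refine finsum_congr fun z => ?_
    rw [MulAction.toPerm_apply]
    by_cases h : (y, z) ∈ linkEdges X x
    · have hw := haut.weight_eq γ _ h.2.2.2
      simp only [Finset.image_insert, Finset.image_singleton] at hw
      rw [Set.indicator_of_mem h,
        Set.indicator_of_mem ((haut.smul_mem_linkEdges_iff γ).mpr h), hg, hw]
    · rw [Set.indicator_of_notMem h,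
        Set.indicator_of_notMem fun h' => h ((haut.smul_mem_linkEdges_iff γ).mp h')]
  · refine fun x => (hlf.finite_linkVertices x).subset fun y hy => ?_
    by_contra h
    exact hy (hzero x y h)
  · refine fun y => (hlf.finite_linkVertices y).subset fun x hx => ?_
    by_contra h
    exact hx (hzero x y fun h' => h (mem_linkVertices_comm.mp h'))

end Links

/-! ### The Bochner-type formula -/

section Formula

variable {V Y : Type*} [DecidableEq V] [MetricSpace Y] [IsCAT0 Y]
  {X : AbstractSimplicialComplex V} {m : Finset V → ℝ}

theorem tangentSum_add_curvatureSum (hlf : IsLocallyFiniteComplex X) (f : V → Y) (x : V) :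
    tangentSum X m f x + curvatureSum X m f x
      = ∑ᶠ e ∈ linkEdges X x, m {x, e.1, e.2} * dist (f e.1) (f e.2) ^ 2 := by
  unfold tangentSum curvatureSum
  rw [← finsum_mem_add_distrib (hlf.finite_linkEdges x)]
  refine finsum_mem_congr rfl fun e _ => ?_
  unfold curvatureTerm
  ring

/-- $\pi_p$ preserves distances to the base point. -/
theorem radialSum_origin (f : V → Y) (x : V) :
    radialSum X m f x TangentCone.origin
      = ∑ᶠ y ∈ linkVertices X x, m {x, y} * dist (f x) (f y) ^ 2 := by
  unfold radialSum linkMap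
  simp only [TangentCone.dist_origin_sq, TangentCone.length_proj]

/-- Without neighbours every point of the tangent cone minimizes the empty sum, so the barycenter
is unique only if it is the origin. -/
theorem negLaplacian_of_linkVertices_eq_empty (f : V → Y) {x : V} (h : linkVertices X x = ∅) :
    negLaplacian X m f x = TangentCone.origin := by
  unfold negLaplacian
  split_ifs with hu
  · refine hu.unique hu.choose_spec.1 fun q => ?_
    simp [h]
  · rfl

/-- With $B=-\Delta f(x)$, termwise $d(0,F)^2-d(B,F)^2=2\langle F,B\rangle-|B|^2$. The barycenter
condition turns the weighted sum of the inner products into $m(x)|B|^2$, leaving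
$2m(x)|B|^2-m(x)|B|^2$. -/
theorem radialSum_origin_sub (hm : IsAdmissibleWeight X m) (hlf : IsLocallyFiniteComplex X)
    (f : V → Y) (x : V) :
    radialSum X m f x TangentCone.origin - radialSum X m f x (negLaplacian X m f x)
      = m {x} * dist (TangentCone.origin : TangentCone (f x)) (negLaplacian X m f x) ^ 2 := by
  rcases (linkVertices X x).eq_empty_or_nonempty with h | h
  · simp [negLaplacian_of_linkVertices_eq_empty f h, TangentCone.dist_origin_sq,
      TangentCone.length_origin]
  have hx : m {x} ≠ 0 := (hm.pos _ (X.singleton_mem x)).ne'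
  by_cases hu : ∃! W : TangentCone (f x),
      IsBarycenter (linkVertices X x) (fun y => m {x, y} / m {x}) (linkMap f x) W
  · have hB : IsBarycenter (linkVertices X x) (fun y => m {x, y} / m {x}) (linkMap f x)
        (negLaplacian X m f x) := by
      unfold negLaplacian
      rw [dif_pos hu]
      exact hu.choose_spec.1
    set B := negLaplacian X m f x
    have hfin := hlf.finite_linkVertices x
    have hmx := hm.vertex_eq h
    unfold radialSum
    rw [finsum_mem_eq_finite_toFinset_sum _ hfin] at hmx ⊢
    rw [finsum_mem_eq_finite_toFinset_sum _ hfin]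
    rw [← hfin.coe_toFinset] at hB
    have key := hB.sum_innerProduct
    -- Admissibility at $x$ says that the weights $m(x,y)/m(x)$ add up to $1$.
    simp only [div_mul_eq_mul_div, ← Finset.sum_div, ← hmx, div_self hx, one_mul] at key
    rw [div_eq_iff hx] at key
    simp only [TangentCone.dist_sq, TangentCone.innerProduct_origin_left,
      TangentCone.length_origin, ← Finset.sum_sub_distrib]
    rw [Finset.sum_congr rfl (g := fun y => 2 * (m {x, y} *
      TangentCone.innerProduct (linkMap f x y) B) - m {x, y} * B.length ^ 2) (fun y _ => by
        rw [TangentCone.innerProduct_comm B]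
        ring), Finset.sum_sub_distrib, ← Finset.mul_sum, ← Finset.sum_mul, ← hmx, key]
    ring
  -- At the default value both sides vanish, so existence of the barycenter need not be established.
  · have : negLaplacian X m f x = TangentCone.origin := by
      unfold negLaplacian
      rw [dif_neg hu]
    rw [this, TangentCone.dist_origin_sq, TangentCone.length_origin]
    ring

end Formula

end

theorem mainTheorem8 {V Γ Y : Type*} [DecidableEq V] [Group Γ] [Group.FG Γ] [MulAction Γ V]
    [MetricSpace Y] [IsHadamard Y]
    (X : AbstractSimplicialComplex V) (m : Finset V → ℝ)
    (hconn : IsConnectedComplex X) (hlf : IsLocallyFiniteComplex X)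
    (hdim : IsFiniteDimensionalComplex X)
    (hm : IsAdmissibleWeight X m)
    (hedge : ∀ s ∈ kSimplices X 1, (kSimplicesAt X 2 s).Nonempty)
    (haut : ActsByAutomorphisms Γ X m)
    (hpd : ActsProperlyDiscontinuously V Γ) (hcof : ActsCofinitely Γ X)
    (F₀ : Finset V) (hF₀ : IsOrbitRepresentatives Γ F₀)
    (ρ : Γ →* (Y ≃ᵢ Y)) (f : V → Y) (hf : ∀ (γ : Γ) (x : V), f (γ • x) = ρ γ (f x)) :
    (0 = ∑ x ∈ F₀, 1 / (Nat.card (MulAction.stabilizer Γ x) : ℝ) *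
        (tangentSum X m f x - radialSum X m f x TangentCone.origin + curvatureSum X m f x)) ∧
    (∑ x ∈ F₀, m {x} / (Nat.card (MulAction.stabilizer Γ x) : ℝ) *
        dist (TangentCone.origin : TangentCone (f x)) (negLaplacian X m f x) ^ 2
      = ∑ x ∈ F₀, 1 / (Nat.card (MulAction.stabilizer Γ x) : ℝ) *
        (tangentSum X m f x - radialSum X m f x (negLaplacian X m f x)
          + curvatureSum X m f x)) ∧
    (∀ x : V, ∀ e ∈ linkEdges X x, 0 ≤ curvatureTerm f x e.1 e.2) := by
  have formula : 0 = ∑ x ∈ F₀, 1 / (Nat.card (MulAction.stabilizer Γ x) : ℝ) *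
      (tangentSum X m f x - radialSum X m f x TangentCone.origin + curvatureSum X m f x) := by
    have h := hm.sum_linkEdges_eq_sum_linkVertices hlf hedge haut hpd hF₀
      (g := fun x y => dist (f x) (f y) ^ 2) (fun γ x y => by rw [hf, hf, (ρ γ).dist_eq])
    simp only [← fun x => tangentSum_add_curvatureSum (m := m) hlf f x,
      ← fun x => radialSum_origin (X := X) (m := m) f x] at h
    rw [eq_comm, ← sub_eq_zero.mpr h, ← Finset.sum_sub_distrib]
    exact Finset.sum_congr rfl fun x _ => by ring
  refine ⟨formula, ?_, fun x e _ => curvatureTerm_nonneg f x e.1 e.2⟩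
  -- Add the first formula, as a representation of $0$, to the left side; the claim then holds
  -- vertex by vertex.
  rw [← add_zero (∑ x ∈ F₀, m {x} / _ * _), formula, ← Finset.sum_add_distrib]
  refine Finset.sum_congr rfl fun x _ => ?_
  rw [div_mul_eq_mul_div, ← radialSum_origin_sub hm hlf]
  ring
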